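/- For a topological space $X$, let $\mathrm{O}(X)$ be the family of all countable open covers $\mathcal U$ of $X$ with $X\notin\mathcal U$. Let $\Omega(X)$ be the family of those $\mathcal U\in\mathrm{O}(X)$ such that every finite subset of $X$ is contained in a member of $\mathcal U$. Let $\gimel(\Gamma)(X)$ be the family of those $\mathcal U\in\mathrm{O}(X)$ that have a bijective enumeration $\mathcal U=\{U_n : n\in\mathbb N\}$ and a strictly increasing $h:\mathbb N\to\mathbb N$ such that each $x\in X$ satisfies $x\in\bigcup_{k=h(n)}^{h(n+1)-1}U_k$ for all but finitely many $n$. The principle $\mathsf S_1(\mathcal A,\mathcal B)$ says that for all $\mathcal U_0,\mathcal U_1,\ldots\in\mathcal A$ there are $U_n\in\mathcal U_n$ with $\{U_n:n\in\mathbb N\}\in\mathcal B$. A space $X$ is *Rothberger* if $\mathsf S_1(\mathrm{O}(X),\mathrm{O}(X))$ holds, and *Gerlits–Nagy* if $\mathsf S_1(\Omega(X),\gimel(\Gamma)(X))$ holds. Let $\mathrm{cov}(\mathcal M)$ be the minimal number of meager subsets of $\mathbb R$ that cover $\mathbb R$, let $\mathrm{add}(\mathcal N)$ be the minimal number of Lebesgue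 null subsets of $\mathbb R$ whose union is not null, and let $\mathrm{add}(\mathsf S_1(\mathrm O,\mathrm O))$ be the minimal number of Rothberger spaces whose union (a nonempty space containing them as subspaces) is not Rothberger. For an infinite cardinal $\kappa$, define classes $\mathcal C_\alpha(\kappa)$ by transfinite recursion on the ordinal $\alpha$. $\mathcal C_0(\kappa)$ is the class of regular spaces of cardinality $<\kappa$. A space $C$ is in $\mathcal C_{\alpha+1}(\kappa)$ if $C$ is regular and either there is a countable $D\subseteq C$ such that $C\setminus U\in\mathcal C_\alpha(\kappa)$ for all open $U\supseteq D$, or $C$ is a union of fewer than $\mathrm{cf}(\kappa)$ subspaces that belong to $\mathcal C_\alpha(\kappa)$. For limit $\alpha$, $\mathcal C_\alpha(\kappa)=\bigcup_{\beta<\alpha}\mathcal C_\beta(\kappa)$. (Finite and empty spaces are allowed here, and regular spaces need not be $T_1$.) **Theorem.** Let $Y$ be a nonempty Lindelöf Gerlits–Nagy space. Then for every nonempty $C\in\mathcal C_{\mathrm{add}(\mathcal N)}(\mathrm{cov}(\mathcal M))$, the product $C\times Y$ is Rothberger. The same holds for every nonempty $C\in\mathcal C_{\mathrm{add}(\mathsf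 S_1(\mathrm O,\mathrm O))}(\mathrm{cov}(\mathcal M))$. -/

import Mathlib

open Set Filter Topology MeasureTheory

universe u v w

noncomputable section

/-- Countable open covers of `X`; the whole space is not allowed as a member of a cover. -/
def OpenCovers (X : Type u) [TopologicalSpace X] : Set (Set (Set X)) :=
  {𝒰 | 𝒰.Countable ∧ (∀ U ∈ 𝒰, IsOpen U) ∧ ⋃₀ 𝒰 = univ ∧ univ ∉ 𝒰}

/-- Countable open `ω`-covers: every finite subset of `X` lies in a member of the cover. -/
def OmegaCovers (X : Type u) [TopologicalSpace X] : Set (Set (Set X)) :=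
  {𝒰 | 𝒰 ∈ OpenCovers X ∧ ∀ F : Set X, F.Finite → ∃ U ∈ 𝒰, F ⊆ U}

/-- The covers in `ℷ(Γ)`: for some bijective enumeration `U₀, U₁, …` of the cover, there is an
increasing `h : ℕ → ℕ` such that every point belongs to `⋃ {U_k : h n ≤ k < h (n + 1)}` for all
but finitely many `n`. -/
def GimelGammaCovers (X : Type u) [TopologicalSpace X] : Set (Set (Set X)) :=
  {𝒰 | 𝒰 ∈ OpenCovers X ∧ ∃ (e : ℕ ≃ 𝒰) (h : ℕ → ℕ), StrictMono h ∧
    ∀ x : X, ∀ᶠ n in atTop, ∃ k ∈ Ico (h n) (h (n + 1)), x ∈ (e k : Set X)}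

/-- The selection principle `S₁(𝒜, ℬ)`. -/
def SelectOne {X : Type u} (𝒜 ℬ : Set (Set (Set X))) : Prop :=
  ∀ 𝒰 : ℕ → Set (Set X), (∀ n, 𝒰 n ∈ 𝒜) →
    ∃ U : ℕ → Set X, (∀ n, U n ∈ 𝒰 n) ∧ range U ∈ ℬ

/-- Rothberger's property `S₁(O, O)`. -/
def IsRothberger (X : Type u) [TopologicalSpace X] : Prop :=
  SelectOne (OpenCovers X) (OpenCovers X)

/-- The Gerlits–Nagy property `S₁(Ω, ℷ(Γ))`. -/
def IsGerlitsNagy (X : Type u) [TopologicalSpace X] : Prop :=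
  SelectOne (OmegaCovers X) (GimelGammaCovers X)

/-- `cov(M)`: the minimal number of meager sets of reals covering the real line. -/
def covMeager : Cardinal.{0} :=
  sInf {κ | ∃ A : Set (Set ℝ), Cardinal.mk A = κ ∧ (∀ s ∈ A, IsMeagre s) ∧ ⋃₀ A = univ}

/-- `add(N)`: the minimal number of Lebesgue null sets of reals whose union is not null. -/
def addNull : Cardinal.{0} :=
  sInf {κ | ∃ A : Set (Set ℝ), Cardinal.mk A = κ ∧ (∀ s ∈ A, volume s = 0) ∧ volume (⋃₀ A) ≠ 0}

/-- `add(S₁(O, O))`: the minimal number of Rothberger spaces (subspaces of a common nonempty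
space) whose union is not Rothberger. -/
def addRothberger : Cardinal.{w} :=
  sInf {κ | ∃ (X : Type w) (_ : TopologicalSpace X) (F : Set (Set X)),
    Nonempty X ∧ Cardinal.mk F = κ ∧ (∀ A ∈ F, IsRothberger A) ∧ ⋃₀ F = univ ∧ ¬ IsRothberger X}

/-- One successor step of the hierarchy: from a class `P` of spaces to the class of regular spaces
`C` such that either `C ∖ U` is in `P` for all open `U` containing some fixed countable `D ⊆ C`, or
`C` is a union of less than `cf κ` subspaces in `P`. -/
def ConcentratedStep (κ : Cardinal.{u}) (P : (X : Type u) → TopologicalSpace X → Prop)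
    (C : Type u) (t : TopologicalSpace C) : Prop :=
  RegularSpace C ∧
    ((∃ D : Set C, D.Countable ∧ ∀ U : Set C, IsOpen U → D ⊆ U →
        P (Uᶜ : Set C) inferInstance) ∨
      ∃ F : Set (Set C), Cardinal.mk F < κ.ord.cof ∧ ⋃₀ F = univ ∧
        ∀ A ∈ F, P A inferInstance)

/-- The hierarchy `C_α(κ)` of classes of spaces, by transfinite recursion on `α`. -/
def ConcentratedHierarchy (κ : Cardinal.{u}) (α : Ordinal.{w}) :
    (X : Type u) → TopologicalSpace X → Prop :=
  Ordinal.limitRecOn (motive := fun _ => (X : Type u) → TopologicalSpace X → Prop) α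
    (fun X _ => RegularSpace X ∧ Cardinal.mk X < κ)
    (fun _ P => ConcentratedStep κ P)
    (fun γ _ P X t => ∃ (β : Ordinal.{w}) (hβ : β < γ), P β hβ X t)

end

/-! Call a subset of `C` small if it is a countable union of sets of size below cov(M). One
selection from countable open covers `U n` of `C × Y` covers the cylinder over any small set.
Indeed, for each point `c` the Gerlits–Nagy property gives finite partial selections, with supports
tending to infinity, almost all of which cover a given `y` (`exists_eventually_cover`). For fewer
than cov(M) points, a real outside the associated meagre sets codes one `g` that extends infinitely
many partial selections of each point (`exists_frequently_eq_of_lt_covMeager`); splitting ℕ into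
countably many rows handles small sets.

The hierarchy is climbed by strategies in a game (`HasSmallStrategy`), by induction on the level and
with no bound on it. In the concentrated case ONE opens with `D`; the Hurewicz property reduces what
TWO's answer misses to cylinders over countably many complements of open supersets of `D`
(`exists_open_supersets`), whose strategies are then run in parallel. In the end one row of covers
handles each move of ONE, and a spare row handles the small remainder. -/

/-! ### Covering consequences of the Gerlits–Nagy property. -/

theorem IsGerlitsNagy.exists_eventually_cover {Y : Type v} [TopologicalSpace Y]
    (hY : IsGerlitsNagy Y) {V : ℕ → ℕ → Set Y} (hVo : ∀ n k, IsOpen (V n k))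
    (hVc : ∀ n y, ∃ k, y ∈ V n k) :
    ∃ (F : ℕ → Finset ℕ) (s : ℕ → ℕ → ℕ), (∀ m, ∀ i ∈ F m, m ≤ i) ∧
      ∀ y, ∀ᶠ m in atTop, ∃ i ∈ F m, y ∈ V i (s m i) := by
  -- Members of `OmegaCovers` must differ from `univ`. Either finite selections arbitrarily far out
  -- already cover `Y`, or for some `N` none beyond `N` does, which keeps the sets `W n a` below
  -- proper.
  by_cases hfin : ∀ N, ∃ (F : Finset ℕ) (s : ℕ → ℕ), (∀ i ∈ F, N ≤ i) ∧
      ∀ y, ∃ i ∈ F, y ∈ V i (s i)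
  · choose F s hF hs using hfin
    exact ⟨F, s, hF, fun y => Eventually.of_forall fun m => hs m y⟩
  push Not at hfin
  obtain ⟨N, hN⟩ := hfin
  -- The members of the `n`-th `ω`-cover use only indices of the form `pair n r`.
  let W : ℕ → List ℕ → Set Y := fun n a =>
    ⋃ r ∈ Finset.range a.length, V (Nat.pair n (N + r)) (a.getD r 0)
  have hWne : ∀ n a, W n a ≠ univ := by
    intro n a h
    obtain ⟨y, hy⟩ := hN ((Finset.range a.length).image fun r => Nat.pair n (N + r))
      (fun i => a.getD ((Nat.unpair i).2 - N) 0) (by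
        intro i hi
        obtain ⟨r, -, rfl⟩ := Finset.mem_image.1 hi
        exact (Nat.le_add_right N r).trans (Nat.right_le_pair _ _))
    have hyW : y ∈ W n a := h ▸ mem_univ y
    simp only [W, mem_iUnion] at hyW
    obtain ⟨r, hr, hyr⟩ := hyW
    refine hy _ (Finset.mem_image_of_mem _ hr) ?_
    simpa using hyr
  have hWfin : ∀ n (F : Set Y), F.Finite → ∃ a, F ⊆ W n a := by
    intro n F hF
    induction F, hF using Set.Finite.induction_on with
    | empty => exact ⟨[], empty_subset _⟩
    | @insert y F _ _ ih =>
      obtain ⟨a, ha⟩ := ih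
      obtain ⟨k, hk⟩ := hVc (Nat.pair n (N + a.length)) y
      refine ⟨a ++ [k], insert_subset ?_ fun z hz => ?_⟩
      · simp only [W, mem_iUnion]
        exact ⟨a.length, by simp, by simpa using hk⟩
      · have := ha hz
        simp only [W, mem_iUnion, Finset.mem_range] at this ⊢
        obtain ⟨r, hr, hzr⟩ := this
        refine ⟨r, by simp; omega, ?_⟩
        rwa [List.getD_append _ _ _ _ hr]
  have hWΩ : ∀ n, range (W n) ∈ OmegaCovers Y := by
    intro n
    refine ⟨⟨countable_range _, ?_, ?_, ?_⟩, ?_⟩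
    · rintro _ ⟨a, rfl⟩
      exact isOpen_biUnion fun r _ => hVo _ _
    · refine eq_univ_of_forall fun y => ?_
      obtain ⟨a, ha⟩ := hWfin n {y} (finite_singleton y)
      exact ⟨W n a, mem_range_self a, ha rfl⟩
    · rintro ⟨a, ha⟩
      exact hWne n a ha
    · intro F hF
      obtain ⟨a, ha⟩ := hWfin n F hF
      exact ⟨_, mem_range_self a, ha⟩
  obtain ⟨U, hUmem, -, e, h, hmono, hcov⟩ := hY (fun n => range (W n)) hWΩ
  choose a ha using hUmem
  have hidx : ∀ k, ∃ n, U n = e k := fun k => (e k).2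
  choose idx hidx using hidx
  -- Bijectivity of the enumeration `e` is what pushes the blocks `F m` to infinity.
  have hinj : Function.Injective idx := fun k l hkl =>
    e.injective (Subtype.ext (by rw [← hidx k, ← hidx l, hkl]))
  let F : ℕ → Finset ℕ := fun m => (Finset.Ico (h m) (h (m + 1))).biUnion fun k =>
    (Finset.range (a (idx k)).length).image fun r => Nat.pair (idx k) (N + r)
  let s : ℕ → ℕ := fun i => (a (Nat.unpair i).1).getD ((Nat.unpair i).2 - N) 0
  have hF : ∀ M, ∀ᶠ m in atTop, ∀ i ∈ F m, M ≤ i := by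
    intro M
    have h1 : ∀ᶠ k in atTop, M ≤ idx k :=
      (Nat.cofinite_eq_atTop ▸ hinj.tendsto_cofinite).eventually_ge_atTop M
    obtain ⟨K, hK⟩ := eventually_atTop.1 h1
    filter_upwards [eventually_ge_atTop K] with m hm i hi
    obtain ⟨k, hk, hi⟩ := Finset.mem_biUnion.1 hi
    obtain ⟨r, -, rfl⟩ := Finset.mem_image.1 hi
    exact (hK k (hm.trans ((hmono.id_le m).trans (Finset.mem_Ico.1 hk).1))).trans
      (Nat.left_le_pair _ _)
  have hs : ∀ y, ∀ᶠ m in atTop, ∃ i ∈ F m, y ∈ V i (s i) := by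
    intro y
    filter_upwards [hcov y] with m hm
    obtain ⟨k, hk, hyk⟩ := hm
    rw [← hidx k, ← ha] at hyk
    simp only [W, mem_iUnion] at hyk
    obtain ⟨r, hr, hyr⟩ := hyk
    refine ⟨Nat.pair (idx k) (N + r), Finset.mem_biUnion.2
      ⟨k, Finset.mem_Ico.2 hk, Finset.mem_image_of_mem _ hr⟩, ?_⟩
    simpa [s] using hyr
  have hsub : ∀ M, ∃ m, M ≤ m ∧ ∀ i ∈ F m, M ≤ i := fun M =>
    ((eventually_ge_atTop M).and (hF M)).exists
  choose φ hφ hFφ using hsub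
  exact ⟨fun m => F (φ m), fun _ => s, hFφ, fun y =>
    (tendsto_atTop_mono hφ tendsto_id).eventually (hs y)⟩

/-- Gerlits–Nagy spaces have Hurewicz's covering property. -/
theorem IsGerlitsNagy.exists_eventually_mem_lt {Y : Type v} [TopologicalSpace Y]
    (hY : IsGerlitsNagy Y) {V : ℕ → ℕ → Set Y} (hVo : ∀ n k, IsOpen (V n k))
    (hVc : ∀ n y, ∃ k, y ∈ V n k) :
    ∃ g : ℕ → ℕ, ∀ y, ∀ᶠ n in atTop, ∃ k < g n, y ∈ V n k := by
  obtain ⟨F, s, hF, hs⟩ := hY.exists_eventually_cover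
    -- These sets increase with `k` and refine all covers up to `n`, so any index `i ≥ n` in `F n`
    -- controls the `n`-th cover.
    (V := fun n k => ⋂ i ∈ Finset.range (n + 1), ⋃ j ∈ Finset.range k, V i j)
    (fun n k => isOpen_biInter_finset fun i _ => isOpen_biUnion fun j _ => hVo i j) (by
      intro n y
      choose k hk using fun i => hVc i y
      refine ⟨(Finset.range (n + 1)).sup k + 1, ?_⟩
      simp only [mem_iInter, mem_iUnion]
      exact fun i hi => ⟨k i, Finset.mem_range.2
        (Nat.lt_succ_of_le (Finset.le_sup (f := k) hi)), hk i⟩)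
  refine ⟨fun n => (F n).sup (s n), fun y => ?_⟩
  filter_upwards [hs y] with n hn
  obtain ⟨i, hi, hy⟩ := hn
  simp only [mem_iInter, mem_iUnion, Finset.mem_range] at hy
  obtain ⟨j, hj, hy⟩ := hy n (Nat.lt_succ_of_le (hF n i hi))
  exact ⟨j, hj.trans_le (Finset.le_sup (f := s n) hi), hy⟩

theorem IsGerlitsNagy.exists_open_supersets {C : Type u} {Y : Type v} [TopologicalSpace C]
    [TopologicalSpace Y] [Nonempty Y] [LindelofSpace Y] (hY : IsGerlitsNagy Y) {D : Set C}
    (hD : D.Countable) {W : Set (C × Y)} (hW : IsOpen W) (hDW : D ×ˢ univ ⊆ W) :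
    ∃ G : ℕ → Set C, (∀ m, IsOpen (G m)) ∧ (∀ m, D ⊆ G m) ∧ ∀ p ∉ W, ∃ m, p.1 ∉ G m := by
  rcases D.eq_empty_or_nonempty with rfl | hDne
  · exact ⟨fun _ => ∅, fun _ => isOpen_empty, fun _ => empty_subset _, fun p _ => ⟨0, id⟩⟩
  obtain ⟨d, rfl⟩ := hD.exists_eq_range hDne
  have hrect : ∀ n, ∃ (A : ℕ → Set C) (V : ℕ → Set Y), (∀ k, IsOpen (A k)) ∧
      (∀ k, IsOpen (V k)) ∧ (∀ k, d n ∈ A k) ∧ (∀ y, ∃ k, y ∈ V k) ∧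
      ∀ k, A k ×ˢ V k ⊆ W := by
    intro n
    have hloc : ∀ y : Y, ∃ (A : Set C) (V : Set Y), IsOpen A ∧ IsOpen V ∧ d n ∈ A ∧ y ∈ V ∧
        A ×ˢ V ⊆ W := fun y =>
      isOpen_prod_iff.1 hW _ _ (hDW ⟨mem_range_self n, mem_univ y⟩)
    choose A V hA hV hdA hyV hAV using hloc
    obtain ⟨t, ht, htc⟩ := countable_cover_nhds fun y => (hV y).mem_nhds (hyV y)
    have htne : t.Nonempty := by
      obtain ⟨y⟩ := ‹Nonempty Y›
      have := htc ▸ mem_univ y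
      simp only [mem_iUnion] at this
      exact ⟨_, this.choose_spec.choose⟩
    obtain ⟨f, rfl⟩ := ht.exists_eq_range htne
    refine ⟨A ∘ f, V ∘ f, fun _ => hA _, fun _ => hV _, fun _ => hdA _, fun y => ?_,
      fun _ => hAV _⟩
    have := htc ▸ mem_univ y
    simpa using this
  choose A V hA hV hdA hVc hAV using hrect
  obtain ⟨g, hg⟩ := hY.exists_eventually_mem_lt (V := fun n => V (Nat.unpair n).1)
    (fun n k => hV _ k) (fun n y => hVc _ y)
  -- Through `unpair`, each point of `D` recurs at arbitrarily large indices, so the tail union from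
  -- `m` on still contains `D`.
  refine ⟨fun m => ⋃ n ∈ Ici m, ⋂ k ∈ Finset.range (g n), A (Nat.unpair n).1 k,
    fun m => isOpen_biUnion fun n _ => isOpen_biInter_finset fun k _ => hA _ k, ?_, ?_⟩
  · rintro m _ ⟨i, rfl⟩
    simp only [mem_iUnion, mem_iInter]
    refine ⟨Nat.pair i m, Nat.right_le_pair i m, fun k _ => ?_⟩
    simpa using hdA i k
  · rintro ⟨c, y⟩ hp
    obtain ⟨m, hm⟩ := eventually_atTop.1 (hg y)
    refine ⟨m, fun hc => hp ?_⟩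
    simp only [mem_iUnion, mem_iInter, Finset.mem_range] at hc
    obtain ⟨n, hn, hc⟩ := hc
    obtain ⟨k, hk, hy⟩ := hm n hn
    exact hAV _ k ⟨hc k hk, hy⟩

/-! ### Coding Baire space by binary digits; meagre sets of reals. -/

theorem floor_two_pow_mul_of_succ {x : ℝ} {n : ℕ} {j : ℤ} {b : ℤ} (hb : b = 0 ∨ b = 1)
    (h : ⌊2 ^ (n + 1) * x⌋ = 2 * j + b) : ⌊2 ^ n * x⌋ = j := by
  rw [Int.floor_eq_iff] at h ⊢
  rw [pow_succ] at h
  push_cast at h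
  rcases hb with rfl | rfl <;> norm_num at h ⊢ <;> constructor <;> linarith [h.1, h.2]

/-- Binary digits can be prescribed inside a dyadic interval. -/
theorem exists_floor_two_pow_digits (b : ℕ → Prop) (n : ℕ) (j : ℤ) (l : ℕ) :
    ∃ j' : ℤ, ∀ x : ℝ, ⌊2 ^ (n + l) * x⌋ = j' → ⌊2 ^ n * x⌋ = j ∧
      ∀ i, n < i → i ≤ n + l → (Odd ⌊2 ^ i * x⌋ ↔ b i) := by
  classical
  induction l with
  | zero => exact ⟨j, fun x hx => ⟨hx, fun i h1 h2 => by omega⟩⟩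
  | succ l ih =>
    obtain ⟨j', hj'⟩ := ih
    refine ⟨2 * j' + if b (n + l + 1) then 1 else 0, fun x hx => ?_⟩
    obtain ⟨h1, h2⟩ := hj' x (floor_two_pow_mul_of_succ (by split_ifs <;> simp) hx)
    refine ⟨h1, fun i hi hi' => ?_⟩
    rcases hi'.lt_or_eq with hlt | rfl
    · exact h2 i hi (by omega)
    · rw [hx]
      split_ifs with hb
      · simp [hb, ← add_assoc]
      · simp [hb, ← add_assoc]

/-- The `i`-th value is the least `k` for which the binary digit with number `pair i k` is one. -/
noncomputable def bairePoint (x : ℝ) (i : ℕ) : ℕ := sInf {k | Odd ⌊2 ^ Nat.pair i k * x⌋}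

theorem isNowhereDense_bairePoint {F : ℕ → Finset ℕ} {s : ℕ → ℕ → ℕ}
    (hF : ∀ m, ∀ i ∈ F m, m ≤ i) (M : ℕ) :
    IsNowhereDense {x : ℝ | ∀ m ≥ M, ∃ i ∈ F m, bairePoint x i ≠ s m i} := by
  rw [IsNowhereDense, interior_eq_empty_iff_dense_compl, ← interior_compl]
  refine dense_iff_inter_open.2 fun I hI ⟨x₀, hx₀⟩ => ?_
  obtain ⟨ε, hε, hball⟩ := Metric.isOpen_iff.1 hI x₀ hx₀
  obtain ⟨n, hn⟩ := exists_pow_lt_of_lt_one hε (by norm_num : (1 / 2 : ℝ) < 1)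
  have h2 : ∀ n : ℕ, (0 : ℝ) < 2 ^ n := fun n => by positivity
  have hI' : ∀ x : ℝ, ⌊2 ^ n * x⌋ = ⌊2 ^ n * x₀⌋ → x ∈ I := by
    intro x hx
    apply hball
    rw [Metric.mem_ball, Real.dist_eq]
    refine lt_trans ?_ hn
    have := Int.abs_sub_lt_one_of_floor_eq_floor hx
    rw [← mul_sub, abs_mul, abs_of_pos (h2 n)] at this
    rw [one_div, inv_pow, ← one_div, lt_div_iff₀ (h2 n)]
    linarith
  -- Since `pair i k ≥ i ≥ m > n`, the digits that determine `bairePoint` on `F m` are not yet fixed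
  -- by the dyadic interval of level `n`.
  let m := max M (n + 1)
  let l := (F m).sup fun i => Nat.pair i (s m i)
  obtain ⟨j, hj⟩ := exists_floor_two_pow_digits
    (fun q => (Nat.unpair q).2 = s m (Nat.unpair q).1) n ⌊2 ^ n * x₀⌋ l
  have key : ∀ x : ℝ, ⌊2 ^ (n + l) * x⌋ = j →
      x ∈ I ∩ {x : ℝ | ∀ m ≥ M, ∃ i ∈ F m, bairePoint x i ≠ s m i}ᶜ := by
    intro x hx
    obtain ⟨h1, hd⟩ := hj x hx
    refine ⟨hI' x h1, fun hbad => ?_⟩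
    obtain ⟨i, hi, hne⟩ := hbad m (le_max_left _ _)
    have hmi := hF m i hi
    have hdig : ∀ k ≤ s m i, (Odd ⌊2 ^ Nat.pair i k * x⌋ ↔ k = s m i) := by
      intro k hk
      have hle : Nat.pair i k ≤ l :=
        ((StrictMono.monotone fun _ _ => Nat.pair_lt_pair_right i) hk).trans
          (Finset.le_sup (f := fun i => Nat.pair i (s m i)) hi)
      have hlt : n < Nat.pair i k :=
        lt_of_lt_of_le ((le_max_right M (n + 1)).trans hmi) (Nat.left_le_pair i k)
      simpa using hd _ hlt (by omega)
    refine hne (le_antisymm (Nat.sInf_le ((hdig _ le_rfl).2 rfl)) ?_)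
    refine le_csInf ⟨_, (hdig _ le_rfl).2 rfl⟩ fun k hk => ?_
    by_contra! hlt
    exact hlt.ne ((hdig k hlt.le).1 hk)
  have hsub : Ioo ((j : ℝ) / 2 ^ (n + l)) ((j + 1) / 2 ^ (n + l)) ⊆
      {x : ℝ | ⌊2 ^ (n + l) * x⌋ = j} := by
    intro x hx
    rw [mem_ofPred_eq, Int.floor_eq_iff]
    rw [mem_Ioo, div_lt_iff₀ (h2 _), lt_div_iff₀ (h2 _)] at hx
    constructor <;> linarith [hx.1, hx.2]
  have hne : (Ioo ((j : ℝ) / 2 ^ (n + l)) ((j + 1) / 2 ^ (n + l))).Nonempty :=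
    nonempty_Ioo.2 (by gcongr; linarith)
  obtain ⟨x, hx⟩ := hne
  refine ⟨x, (key x (hsub hx)).1, ?_⟩
  exact interior_maximal (fun z hz => (key z (hsub hz)).2) isOpen_Ioo hx

theorem isMeagre_bairePoint {F : ℕ → Finset ℕ} {s : ℕ → ℕ → ℕ}
    (hF : ∀ m, ∀ i ∈ F m, m ≤ i) :
    IsMeagre {x : ℝ | ¬ ∃ᶠ m in atTop, ∀ i ∈ F m, bairePoint x i = s m i} := by
  refine (isMeagre_iUnion fun M => (isNowhereDense_bairePoint hF (s := s) M).isMeagre).mono ?_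
  intro x hx
  rw [mem_ofPred_eq, not_frequently, eventually_atTop] at hx
  obtain ⟨M, hM⟩ := hx
  refine mem_iUnion.2 ⟨M, fun m hm => ?_⟩
  simpa using hM m hm

theorem iUnion_ne_univ_of_lt_covMeager {ι : Type u}
    (hι : Cardinal.mk ι < Cardinal.lift.{u} covMeager) {B : ι → Set ℝ} (hB : ∀ i, IsMeagre (B i)) :
    ⋃ i, B i ≠ univ := by
  intro h
  have hlt : Cardinal.mk (range B) < covMeager := by
    rw [← Cardinal.lift_lt.{0, u}]
    refine lt_of_le_of_lt ?_ hι
    simpa using Cardinal.mk_range_le_lift (f := B)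
  exact notMem_of_lt_csInf' hlt ⟨range B, rfl, by rintro _ ⟨i, rfl⟩; exact hB i, by
    rwa [sUnion_range]⟩

theorem exists_frequently_eq_of_lt_covMeager {ι : Type u}
    (hι : Cardinal.mk ι < Cardinal.lift.{u} covMeager) {F : ι → ℕ → Finset ℕ}
    {s : ι → ℕ → ℕ → ℕ} (hF : ∀ c m, ∀ i ∈ F c m, m ≤ i) :
    ∃ g : ℕ → ℕ, ∀ c, ∃ᶠ m in atTop, ∀ i ∈ F c m, g i = s c m i := by
  obtain ⟨x, hx⟩ := (ne_univ_iff_exists_notMem _).1 (iUnion_ne_univ_of_lt_covMeager hι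
    fun c => isMeagre_bairePoint (hF c) (s := s c))
  refine ⟨bairePoint x, fun c => ?_⟩
  by_contra hc
  exact hx (mem_iUnion.2 ⟨c, hc⟩)

theorem aleph0_lt_covMeager : Cardinal.aleph0 < covMeager := by
  by_contra! h
  obtain ⟨A, hA, hm, hu⟩ : covMeager ∈ {κ | ∃ A : Set (Set ℝ), Cardinal.mk A = κ ∧
      (∀ s ∈ A, IsMeagre s) ∧ ⋃₀ A = univ} :=
    csInf_mem ⟨_, range fun x : ℝ => {x}, rfl, by
      rintro _ ⟨x, rfl⟩
      refine IsNowhereDense.isMeagre ?_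
      simp [IsNowhereDense], by
      rw [sUnion_range, iUnion_of_singleton]⟩
  have hc : A.Countable := Cardinal.le_aleph0_iff_set_countable.1 (hA ▸ h)
  refine not_isMeagre_of_isOpen (X := ℝ) isOpen_univ univ_nonempty ?_
  rw [← hu, sUnion_eq_biUnion]
  exact isMeagre_biUnion hc hm

/-! ### Small sets. -/

/-- The `σ`-ideal generated by the sets of cardinality less than `κ`. -/
def IsSmallUnion (κ : Cardinal.{u}) {X : Type u} (A : Set X) : Prop :=
  ∃ B : ℕ → Set X, (∀ n, Cardinal.mk (B n) < κ) ∧ A = ⋃ n, B n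

namespace IsSmallUnion

variable {κ : Cardinal.{u}} {X : Type u}

theorem of_mk_lt {A : Set X} (h : Cardinal.mk A < κ) : IsSmallUnion κ A :=
  ⟨fun _ => A, fun _ => h, (iUnion_const A).symm⟩

theorem of_countable (hκ : Cardinal.aleph0 < κ) {A : Set X} (h : A.Countable) :
    IsSmallUnion κ A :=
  of_mk_lt (h.le_aleph0.trans_lt hκ)

theorem iUnion_nat {A : ℕ → Set X} (h : ∀ n, IsSmallUnion κ (A n)) :
    IsSmallUnion κ (⋃ n, A n) := by
  choose B hB hA using h
  refine ⟨fun p => B p.unpair.1 p.unpair.2, fun p => hB _ _, ?_⟩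
  simp_rw [hA]
  exact (iUnion_unpair B).symm

theorem iUnion_countable (hκ : Cardinal.aleph0 < κ) {ι : Type w} [Countable ι] {A : ι → Set X}
    (h : ∀ i, IsSmallUnion κ (A i)) : IsSmallUnion κ (⋃ i, A i) := by
  rcases isEmpty_or_nonempty ι with _ | _
  · rw [iUnion_of_empty]
    exact of_countable hκ countable_empty
  · obtain ⟨f, hf⟩ := exists_surjective_nat ι
    rw [← hf.iUnion_comp]
    exact iUnion_nat fun n => h (f n)

theorem mk_lt (hκ : Cardinal.aleph0 < κ) (hcof : Cardinal.aleph0 < κ.ord.cof) {A : Set X}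
    (h : IsSmallUnion κ A) : Cardinal.mk A < κ := by
  obtain ⟨B, hB, rfl⟩ := h
  have h1 := Cardinal.mk_iUnion_le_lift B
  simp only [Cardinal.lift_uzero, Cardinal.mk_nat, Cardinal.lift_aleph0] at h1
  refine h1.trans_lt (Cardinal.mul_lt_of_lt hκ.le hκ ?_)
  have := Cardinal.lift_iSup_lt_of_lt_cof_ord (f := fun n => Cardinal.mk (B n)) (a := κ)
    (by simpa using hcof) hB
  simpa using this

/-- If `κ` has uncountable cofinality, small sets have size below `κ` and the union stays below `κ`;
otherwise the index set is countable. -/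
theorem iUnion_of_mk_lt_cof (hκ : Cardinal.aleph0 < κ) {ι : Type u}
    (hι : Cardinal.mk ι < κ.ord.cof) {A : ι → Set X} (h : ∀ i, IsSmallUnion κ (A i)) : IsSmallUnion κ (⋃ i, A i) := by
  rcases lt_or_ge Cardinal.aleph0 κ.ord.cof with hcof | hcof
  · refine of_mk_lt ((Cardinal.mk_iUnion_le A).trans_lt (Cardinal.mul_lt_of_lt hκ.le
      (hι.trans_le (Ordinal.cof_ord_le κ)) ?_))
    exact Cardinal.iSup_lt_of_lt_cof_ord hι fun i => (h i).mk_lt hκ hcof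
  · have : Countable ι := Cardinal.mk_le_aleph0_iff.1 (hι.le.trans hcof)
    exact iUnion_countable hκ h

theorem image {A : Set X} (h : IsSmallUnion κ A) {Z : Type u} (f : X → Z) :
    IsSmallUnion κ (f '' A) := by
  obtain ⟨B, hB, rfl⟩ := h
  exact ⟨fun n => f '' B n, fun n => Cardinal.mk_image_le.trans_lt (hB n), image_iUnion⟩

end IsSmallUnion

/-! ### The game and its strategies along the hierarchy. -/

/-- In the game where ONE plays small sets `A 0, A 1, … ⊆ C` and TWO answers with open sets
`W n ⊇ A n ×ˢ univ`, ONE has a strategy confining the part of `C × Y` missed by all `W n` to the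
cylinder over a small set. -/
def HasSmallStrategy (κ : Cardinal.{u}) (Y : Type v) [TopologicalSpace Y] (C : Type u)
    [TopologicalSpace C] : Prop :=
  ∃ σ : List (Set (C × Y)) → Set C, (∀ l, IsSmallUnion κ (σ l)) ∧
    ∀ W : ℕ → Set (C × Y), (∀ n, IsOpen (W n)) →
      (∀ n, σ ((List.range n).map W) ×ˢ univ ⊆ W n) →
      ∃ L : Set C, IsSmallUnion κ L ∧ ∀ p : C × Y, (∀ n, p ∉ W n) → p.1 ∈ L

section Strategy

variable {κ : Cardinal.{u}} {Y : Type v} [TopologicalSpace Y] {C : Type u} [TopologicalSpace C]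

theorem HasSmallStrategy.of_mk_lt (hκ : Cardinal.aleph0 < κ) (h : Cardinal.mk C < κ) :
    HasSmallStrategy κ Y C :=
  ⟨fun _ => ∅, fun _ => .of_countable hκ countable_empty, fun _ _ _ =>
    ⟨univ, .of_mk_lt (by simpa using h), fun _ _ => mem_univ _⟩⟩

/-- A strategy on a subspace, written inside the whole space. -/
theorem HasSmallStrategy.subtype {A : Set C} (h : HasSmallStrategy κ Y A) :
    ∃ σ : List (Set (C × Y)) → Set C, (∀ l, IsSmallUnion κ (σ l)) ∧
      ∀ W : ℕ → Set (C × Y), (∀ n, IsOpen (W n)) →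
        (∀ n, σ ((List.range n).map W) ×ˢ univ ⊆ W n) →
        ∃ L : Set C, IsSmallUnion κ L ∧ ∀ p : C × Y, p.1 ∈ A → (∀ n, p ∉ W n) → p.1 ∈ L := by
  obtain ⟨σ, hσ, hwin⟩ := h
  let f : A × Y → C × Y := Prod.map Subtype.val id
  have hf : Continuous f := continuous_subtype_val.prodMap continuous_id
  refine ⟨fun l => Subtype.val '' σ (l.map (f ⁻¹' ·)), fun l => (hσ _).image _,
    fun W hW hσW => ?_⟩
  obtain ⟨L, hL, hLW⟩ := hwin (fun n => f ⁻¹' W n) (fun n => (hW n).preimage hf) (by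
    rintro n ⟨a, y⟩ ⟨ha, -⟩
    refine hσW n ⟨mem_image_of_mem _ ?_, mem_univ _⟩
    simpa [Function.comp_def] using ha)
  exact ⟨Subtype.val '' L, hL.image _, fun p hp hpW =>
    ⟨⟨p.1, hp⟩, hLW (⟨p.1, hp⟩, p.2) hpW, rfl⟩⟩

/-- ONE plays all the strategies at once: the union of their moves is small, and an answer to it
answers each of them. -/
theorem HasSmallStrategy.of_sUnion (hκ : Cardinal.aleph0 < κ) {F : Set (Set C)}
    (hF : Cardinal.mk F < κ.ord.cof) (hFC : ⋃₀ F = univ)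
    (h : ∀ A ∈ F, HasSmallStrategy κ Y A) : HasSmallStrategy κ Y C := by
  choose σ hσ hwin using fun A : F => (h A A.2).subtype
  refine ⟨fun l => ⋃ A : F, σ A l, fun l => .iUnion_of_mk_lt_cof hκ hF fun A => hσ A l,
    fun W hW hσW => ?_⟩
  choose L hL hLW using fun A => hwin A W hW fun n =>
    (prod_mono_left (subset_iUnion (fun A : F => σ A ((List.range n).map W)) A)).trans (hσW n)
  refine ⟨⋃ A, L A, .iUnion_of_mk_lt_cof hκ hF hL, fun p hp => ?_⟩
  obtain ⟨A, hA, hpA⟩ := mem_sUnion.1 (hFC ▸ mem_univ p.1)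
  exact mem_iUnion.2 ⟨⟨A, hA⟩, hLW _ p hpA hp⟩

theorem HasSmallStrategy.of_concentrated [Nonempty Y] [LindelofSpace Y] (hY : IsGerlitsNagy Y)
    (hκ : Cardinal.aleph0 < κ) {D : Set C} (hD : D.Countable)
    (h : ∀ U : Set C, IsOpen U → D ⊆ U → HasSmallStrategy κ Y (Uᶜ : Set C)) :
    HasSmallStrategy κ Y C := by
  choose G hGo hDG hGW using fun (W : {W : Set (C × Y) // IsOpen W ∧ D ×ˢ univ ⊆ W}) =>
    hY.exists_open_supersets hD W.2.1 W.2.2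
  choose σ hσ hwin using fun W m => (h (G W m) (hGo W m) (hDG W m)).subtype
  classical
  -- After the opening move `D`, the strategies for the complements of the `G m` see the play
  -- without its first answer. The value `∅` occurs only after an illegal first answer.
  let τ : List (Set (C × Y)) → Set C
    | [] => D
    | W₀ :: l => if hW : IsOpen W₀ ∧ D ×ˢ univ ⊆ W₀ then ⋃ m, σ ⟨W₀, hW⟩ m l else ∅
  refine ⟨τ, fun l => ?_, fun W hW hτ => ?_⟩
  · match l with
    | [] => exact .of_countable hκ hD
    | W₀ :: l =>
      by_cases hW : IsOpen W₀ ∧ D ×ˢ univ ⊆ W₀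
      · simp only [τ, dif_pos hW]
        exact .iUnion_nat fun m => hσ _ m l
      · simp only [τ, dif_neg hW]
        exact .of_countable hκ countable_empty
  · have hW₀ : IsOpen (W 0) ∧ D ×ˢ univ ⊆ W 0 := ⟨hW 0, hτ 0⟩
    have hstep : ∀ m n, σ ⟨W 0, hW₀⟩ m ((List.range n).map fun i => W (i + 1)) ×ˢ univ ⊆
        W (n + 1) := by
      intro m n
      refine Subset.trans (prod_mono_left ?_) (hτ (n + 1))
      simp only [List.range_succ_eq_map, List.map_cons, List.map_map, τ, dif_pos hW₀]
      exact subset_iUnion (fun m => σ ⟨W 0, hW₀⟩ m _) m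
    choose L hL hLW using fun m => hwin ⟨W 0, hW₀⟩ m (fun n => W (n + 1))
      (fun n => hW (n + 1)) (hstep m)
    refine ⟨⋃ m, L m, .iUnion_nat hL, fun p hp => ?_⟩
    obtain ⟨m, hm⟩ := hGW ⟨W 0, hW₀⟩ p (hp 0)
    exact mem_iUnion.2 ⟨m, hLW m p hm fun n => hp (n + 1)⟩

theorem ConcentratedHierarchy.hasSmallStrategy [Nonempty Y] [LindelofSpace Y]
    (hY : IsGerlitsNagy Y) (hκ : Cardinal.aleph0 < κ) (α : Ordinal.{w}) :
    ∀ (C : Type u) (t : TopologicalSpace C), ConcentratedHierarchy κ α C t →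
      HasSmallStrategy κ Y C := by
  induction α using Ordinal.limitRecOn with
  | zero =>
    intro C t h
    rw [ConcentratedHierarchy, Ordinal.limitRecOn_zero] at h
    exact .of_mk_lt hκ h.2
  | add_one α ih =>
    intro C t h
    rw [ConcentratedHierarchy, Ordinal.limitRecOn_add_one] at h
    obtain ⟨-, ⟨D, hD, hDU⟩ | ⟨F, hF, hFC, hFP⟩⟩ := h
    · exact .of_concentrated hY hκ hD fun U hU hDU' => ih _ _ (hDU U hU hDU')
    · exact .of_sUnion hκ hF hFC fun A hA => ih _ _ (hFP A hA)
  | limit α hα ih =>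
    intro C t h
    rw [ConcentratedHierarchy, Ordinal.limitRecOn_limit _ _ _ _ hα] at h
    obtain ⟨β, hβ, h⟩ := h
    exact ih β hβ C t h

end Strategy

/-! ### From strategies to selections. -/

section Selection

variable {C : Type u} [TopologicalSpace C] {Y : Type v} [TopologicalSpace Y]
  {U : ℕ → ℕ → Set (C × Y)}

theorem IsGerlitsNagy.exists_prod_subset_of_mk_lt (hY : IsGerlitsNagy Y)
    (hUo : ∀ n k, IsOpen (U n k)) (hUc : ∀ n p, ∃ k, p ∈ U n k) {A : Set C}
    (hA : Cardinal.mk A < Cardinal.lift.{u} covMeager) :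
    ∃ g : ℕ → ℕ, A ×ˢ univ ⊆ ⋃ n, U n (g n) := by
  choose F s hF hs using fun c : A => hY.exists_eventually_cover
    (V := fun n k => Prod.mk c.1 ⁻¹' U n k)
    (fun n k => (hUo n k).preimage (Continuous.prodMk_right c.1)) (fun n y => hUc n (c.1, y))
  obtain ⟨g, hg⟩ := exists_frequently_eq_of_lt_covMeager hA (s := s) hF
  refine ⟨g, ?_⟩
  rintro ⟨c, y⟩ ⟨hc, -⟩
  obtain ⟨m, hm, i, hi, hy⟩ := ((hg ⟨c, hc⟩).and_eventually (hs ⟨c, hc⟩ y)).exists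
  refine mem_iUnion.2 ⟨i, ?_⟩
  rw [hm i hi]
  exact hy

theorem IsGerlitsNagy.exists_prod_subset (hY : IsGerlitsNagy Y)
    (hUo : ∀ n k, IsOpen (U n k)) (hUc : ∀ n p, ∃ k, p ∈ U n k) {A : Set C}
    (hA : IsSmallUnion (Cardinal.lift.{u} covMeager) A) :
    ∃ g : ℕ → ℕ, A ×ˢ univ ⊆ ⋃ n, U n (g n) := by
  obtain ⟨B, hB, rfl⟩ := hA
  choose g hg using fun i => hY.exists_prod_subset_of_mk_lt
    (U := fun n => U (Nat.pair i n)) (fun _ _ => hUo _ _) (fun _ _ => hUc _ _) (hB i)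
  refine ⟨fun n => g n.unpair.1 n.unpair.2, ?_⟩
  rintro ⟨c, y⟩ ⟨hc, -⟩
  obtain ⟨i, hi⟩ := mem_iUnion.1 hc
  obtain ⟨n, hn⟩ := mem_iUnion.1 (hg i ⟨hi, mem_univ y⟩)
  exact mem_iUnion.2 ⟨Nat.pair i n, by simpa using hn⟩

theorem HasSmallStrategy.exists_selection (hY : IsGerlitsNagy Y)
    (hC : HasSmallStrategy (Cardinal.lift.{u} covMeager) Y C)
    (hUo : ∀ n k, IsOpen (U n k)) (hUc : ∀ n p, ∃ k, p ∈ U n k) :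
    ∃ g : ℕ → ℕ, ⋃ n, U n (g n) = univ := by
  obtain ⟨σ, hσ, hwin⟩ := hC
  have hsel : ∀ (i : ℕ) (A : Set C), IsSmallUnion (Cardinal.lift.{u} covMeager) A →
      ∃ g : ℕ → ℕ, A ×ˢ univ ⊆ ⋃ n, U (Nat.pair i n) (g n) := fun i A hA =>
    hY.exists_prod_subset (U := fun n => U (Nat.pair i n)) (fun _ _ => hUo _ _)
      (fun _ _ => hUc _ _) hA
  -- Row `i + 1` answers move `i`; row `0` is kept for the remainder `L`, known only after the whole
  -- play.
  choose g hg using fun (i : ℕ) (l : List (Set (C × Y))) => hsel (i + 1) (σ l) (hσ l)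
  let answer : ℕ → List (Set (C × Y)) → Set (C × Y) := fun i l =>
    ⋃ n, U (Nat.pair (i + 1) n) (g i l n)
  let play : ℕ → List (Set (C × Y)) := fun n => n.rec [] fun i l => l ++ [answer i l]
  let W : ℕ → Set (C × Y) := fun n => answer n (play n)
  have hplay : ∀ n, (List.range n).map W = play n := by
    intro n
    induction n with
    | zero => rfl
    | succ n ih =>
      rw [List.range_succ, List.map_append, ih]
      rfl
  obtain ⟨L, hL, hLW⟩ := hwin W (fun n => isOpen_iUnion fun k => hUo _ _)
    (fun n => by rw [hplay]; exact hg n (play n))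
  obtain ⟨g₀, hg₀⟩ := hsel 0 L hL
  refine ⟨fun n => match n.unpair.1 with
    | 0 => g₀ n.unpair.2
    | i + 1 => g i (play i) n.unpair.2, eq_univ_of_forall fun p => ?_⟩
  by_cases hp : ∀ n, p ∉ W n
  · obtain ⟨n, hn⟩ := mem_iUnion.1 (hg₀ ⟨hLW p hp, mem_univ p.2⟩)
    exact mem_iUnion.2 ⟨Nat.pair 0 n, by simpa using hn⟩
  · push Not at hp
    obtain ⟨i, hi⟩ := hp
    obtain ⟨n, hn⟩ := mem_iUnion.1 hi
    exact mem_iUnion.2 ⟨Nat.pair (i + 1) n, by simpa using hn⟩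

end Selection

theorem isRothberger_of_exists_selection {X : Type u} [TopologicalSpace X] [Nonempty X]
    (h : ∀ U : ℕ → ℕ → Set X, (∀ n k, IsOpen (U n k)) → (∀ n x, ∃ k, x ∈ U n k) →
      ∃ g : ℕ → ℕ, ⋃ n, U n (g n) = univ) : IsRothberger X := by
  intro 𝒰 h𝒰
  have henum : ∀ n, ∃ U : ℕ → Set X, 𝒰 n = range U := by
    intro n
    obtain ⟨hc, -, hu, -⟩ := h𝒰 n
    -- Nonemptiness of `X` rules out the empty cover, so an enumeration by ℕ, possibly with
    -- repetitions, exists.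
    refine hc.exists_eq_range (nonempty_iff_ne_empty.2 fun h0 => ?_)
    rw [h0, sUnion_empty] at hu
    exact empty_ne_univ hu
  choose U hU using henum
  have hmem : ∀ n k, U n k ∈ 𝒰 n := fun n k => hU n ▸ mem_range_self k
  obtain ⟨g, hg⟩ := h U (fun n k => (h𝒰 n).2.1 _ (hmem n k)) (fun n x => by
    have := (h𝒰 n).2.2.1 ▸ mem_univ x
    rwa [hU n, sUnion_range, mem_iUnion] at this)
  refine ⟨fun n => U n (g n), fun n => hmem n _, countable_range _, ?_, ?_, ?_⟩
  · rintro _ ⟨n, rfl⟩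
    exact (h𝒰 n).2.1 _ (hmem n _)
  · rwa [sUnion_range]
  · rintro ⟨n, hn⟩
    exact (h𝒰 n).2.2.2 (hn ▸ hmem n (g n))

/-- The product theorem holds at every level of the hierarchy. -/
theorem ConcentratedHierarchy.isRothberger_prod {C : Type u} [tC : TopologicalSpace C] [Nonempty C]
    {Y : Type v} [TopologicalSpace Y] [Nonempty Y] [LindelofSpace Y] (hY : IsGerlitsNagy Y)
    {α : Ordinal.{w}} (hC : ConcentratedHierarchy (Cardinal.lift.{u} covMeager) α C tC) :
    IsRothberger (C × Y) :=
  isRothberger_of_exists_selection fun _ hUo hUc =>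
    (ConcentratedHierarchy.hasSmallStrategy hY (by simpa using aleph0_lt_covMeager) α C tC
      hC).exists_selection hY hUo hUc

theorem theorem3p3 (C : Type u) [tC : TopologicalSpace C] [Nonempty C]
    (Y : Type v) [TopologicalSpace Y] [Nonempty Y] [LindelofSpace Y] (hY : IsGerlitsNagy Y) :
    (ConcentratedHierarchy (Cardinal.lift.{u} covMeager) addNull.ord C tC →
      IsRothberger (C × Y)) ∧
    (ConcentratedHierarchy (Cardinal.lift.{u} covMeager) addRothberger.{max u v}.ord C tC →
      IsRothberger (C × Y)) :=
  ⟨fun h => h.isRothberger_prod hY, fun h => h.isRothberger_prod hY⟩
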